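/- Conventions. Let $q$ be a power of a prime $p$ and $n\ge 1$. On $\mathbf F_q^{2n}$ let $\langle (a|b)\,|\,(a'|b')\rangle_s=\operatorname{tr}_{q/p}(a'\cdot b-a\cdot b')$, let $C^{\perp_s}$ be the dual of an additive code $C$ for this form, and let $\operatorname{swt}(a|b)=|\{i:(a_i,b_i)\ne(0,0)\}|$. Let $\{|x\rangle: x\in\mathbf F_q^n\}$ be the computational basis of $\mathbf C^{q^n}$ and $X(a)Z(b)|x\rangle=e^{2\pi i\operatorname{tr}_{q/p}(b\cdot x)/p}|x+a\rangle$, an error of weight $\operatorname{swt}(a|b)$. A subsystem code is a subspace $Q=A\otimes B$ of $\mathbf C^{q^n}$; with $P$ the orthogonal projection onto $Q$, an error $E$ is detected by $A$ if $PEP$ acts on $Q$ as $1_A\otimes M$ for some operator $M$ on $B$. Let $0\ne C\le\mathbf F_q^{2n}$ be an additive code and $D=C\cap C^{\perp_s}$. An $((n,K,R,d))_q$ Clifford subsystem code derived from $C$ is a subsystem code $Q=A\otimes B$ with $\dim A=K=q^n/(|C||D|)^{1/2}$ and $\dim B=R=(|C|/|D|)^{1/2}$ such that the errors $X(a)Z(b)$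 with $(a|b)\in C$ preserve $Q$ and act on it trivially on $A$ and irreducibly on $B$, such that $A$ detects all errors of weight less than $d$, and where $d$ is the least symplectic weight of an element of $D^{\perp_s}\setminus C$ (of $D^{\perp_s}\setminus\{0\}$ if $D^{\perp_s}=C$). Write $[[n,k,r,d]]_q$ for $((n,q^k,q^r,d))_q$. If $n=q^m-1$, the primitive narrow-sense BCH code of designed distance $\delta$ (with respect to a primitive $n$-th root of unity $\alpha$) is the cyclic code of length $n$ over $\mathbf F_q$ with defining set $C_1\cup\dots\cup C_{\delta-1}$, where $C_a=\{aq^i\bmod n: i\ge0\}$, i.e. the set of words $c$ with $\sum_i c_i\alpha^{ti}=0$ for all $t$ in this set. A subsystem BCH code (of designed distance $\delta$) is a Clifford subsystem code derived from an additive code $C$ such that $D^{\perp_s}=\{(a|b): a,b\in \mathcal B\}$ for a primitive narrow-sense BCH code $\mathcal B$ of designed distance $\delta$. Theorem. Let $q$ be a power of a prime, $m$ a positive integer, $n=q^m-1$, and let $\delta$ be an integer with $$2\le\delta\le q^{\lceil m/2\rceil}-1-(q-2)[m\text{ odd}],$$ where $[m\text{ odd}]$ is $1$ if $m$ is odd and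 $0$ otherwise. Then for every integer $r$ with $0\le r<n-2m\lceil(\delta-1)(1-1/q)\rceil$ there exist an integer $d\ge\delta$ and a subsystem BCH code of designed distance $\delta$ with parameters $$[[\,q^m-1,\ n-2m\lceil(\delta-1)(1-1/q)\rceil-r,\ r,\ d\,]]_q .$$ -/

import Mathlib

open scoped Matrix Kronecker

noncomputable section

/-- The symplectic weight of `(a|b)`: the number of positions `i` with `(aᵢ, bᵢ) ≠ (0, 0)`. -/
def sympWeight {F : Type*} [Field F] [DecidableEq F] {n : ℕ}
    (v : (Fin n → F) × (Fin n → F)) : ℕ :=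
  (Finset.univ.filter fun i => v.1 i ≠ 0 ∨ v.2 i ≠ 0).card

/-- The trace-symplectic product `⟨(a|b) | (a'|b')⟩ₛ = tr (a' · b - a · b')`, where `tr` is the
trace from `F` to its prime field. -/
def traceSymp (p : ℕ) {F : Type*} [Field F] [Algebra (ZMod p) F] {n : ℕ}
    (v w : (Fin n → F) × (Fin n → F)) : ZMod p :=
  Algebra.trace (ZMod p) F (w.1 ⬝ᵥ v.2 - v.1 ⬝ᵥ w.2)

/-- The trace-symplectic dual of an additive code. -/
def sympDual (p : ℕ) {F : Type*} [Field F] [Algebra (ZMod p) F] {n : ℕ}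
    (C : AddSubgroup ((Fin n → F) × (Fin n → F))) :
    AddSubgroup ((Fin n → F) × (Fin n → F)) where
  carrier := {v | ∀ w ∈ C, traceSymp p v w = 0}
  zero_mem' := by
    intro w _
    simp [traceSymp]
  add_mem' := by
    intro u v hu hv w hw
    have h1 := hu w hw
    have h2 := hv w hw
    simp only [traceSymp, Prod.fst_add, Prod.snd_add, dotProduct_add, add_dotProduct] at h1 h2 ⊢
    rw [add_sub_add_comm, map_add, h1, h2, add_zero]
  neg_mem' := by
    intro v hv w hw
    have h1 := hv w hw
    simp only [traceSymp, Prod.fst_neg, Prod.snd_neg, dotProduct_neg, neg_dotProduct] at h1 ⊢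
    rw [neg_sub_neg, ← neg_sub, map_neg, h1, neg_zero]

/-- The error operator `X(a) Z(b)` on `ℂ^(q^n)`, whose computational basis is indexed by `F^n`:
`X(a) Z(b) |x⟩ = ω ^ tr (b · x) |x + a⟩`, with `ω = exp (2πi / p)`. -/
def errorOp (p : ℕ) [NeZero p] {F : Type*} [Field F] [DecidableEq F] [Algebra (ZMod p) F]
    {n : ℕ} (v : (Fin n → F) × (Fin n → F)) : Matrix (Fin n → F) (Fin n → F) ℂ :=
  Matrix.of fun y x =>
    if y = x + v.1 then ZMod.stdAddChar (Algebra.trace (ZMod p) F (v.2 ⬝ᵥ x)) else 0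

/-- A subspace `Q = A ⊗ B` of `ℂ^(q^n)` with `dim A = K` and `dim B = R` is given by a linear
isometry `U : ℂ^K ⊗ ℂ^R → ℂ^(q^n)` with range `Q`; the columns of `U` form an orthonormal basis
of `Q` of the form `|i⟩ ⊗ |j⟩`.  The pair is a subsystem code that detects on `A` all errors of
weight less than `d` if each such error `E`, compressed to `Q`, has the form `1 ⊗ M`.
(Scalar multiples of the operators `X(a) Z(b)` have the same property.) -/
structure IsSubsystemCode (p : ℕ) [NeZero p] {F : Type*} [Field F] [Fintype F] [DecidableEq F]
    [Algebra (ZMod p) F] {n : ℕ} (K R d : ℕ)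
    (U : Matrix (Fin n → F) (Fin K × Fin R) ℂ) : Prop where
  isometry : Uᴴ * U = 1
  detects : ∀ v : (Fin n → F) × (Fin n → F), sympWeight v < d →
    ∃ M : Matrix (Fin R) (Fin R) ℂ,
      Uᴴ * errorOp p v * U = (1 : Matrix (Fin K) (Fin K) ℂ) ⊗ₖ M

/-- The subsystem code `Q = A ⊗ B` given by `U` is an `((n, K, R, d))_q` Clifford subsystem code
derived from the additive code `C ≠ 0`.  Put `D = C ∩ C^⊥ₛ`.  The errors `X(a) Z(b)` with
`(a|b) ∈ C` (and hence the group they generate) preserve `Q`, act trivially on `A` and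
irreducibly on `B`; the dimensions are `K = q^n / (|C||D|)^(1/2)` and `R = (|C|/|D|)^(1/2)`
(written without roots as `K |C| = q^n R` and `K R |D| = q^n`, so that `Q` is the whole isotypic
component); and `d` is the least symplectic weight of `D^⊥ₛ \ C`, respectively of
`D^⊥ₛ \ {0}` in case `D^⊥ₛ = C`. -/
structure IsCliffordSubsystemCode (p : ℕ) [NeZero p] {F : Type*} [Field F] [Fintype F]
    [DecidableEq F] [Algebra (ZMod p) F] {n : ℕ}
    (C : AddSubgroup ((Fin n → F) × (Fin n → F))) (K R d : ℕ)
    (U : Matrix (Fin n → F) (Fin K × Fin R) ℂ) : Prop where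
  isSubsystemCode : IsSubsystemCode p K R d U
  ne_bot : C ≠ ⊥
  card_code : K * Nat.card C = Fintype.card F ^ n * R
  card_radical : K * R * Nat.card (C ⊓ sympDual p C : AddSubgroup _) = Fintype.card F ^ n
  gauge : ∃ M : (Fin n → F) × (Fin n → F) → Matrix (Fin R) (Fin R) ℂ,
    (∀ c ∈ C, errorOp p c * U = U * ((1 : Matrix (Fin K) (Fin K) ℂ) ⊗ₖ M c)) ∧
    ∀ W : Submodule ℂ (Fin R → ℂ), (∀ c ∈ C, ∀ w ∈ W, M c *ᵥ w ∈ W) → W = ⊥ ∨ W = ⊤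
  dist_of_ne : sympDual p (C ⊓ sympDual p C) ≠ C →
    IsLeast {w | ∃ v ∈ sympDual p (C ⊓ sympDual p C), v ∉ C ∧ sympWeight v = w} d
  dist_of_eq : sympDual p (C ⊓ sympDual p C) = C →
    IsLeast {w | ∃ v ∈ sympDual p (C ⊓ sympDual p C), v ≠ 0 ∧ sympWeight v = w} d

/-- The `q`-cyclotomic coset of `x` modulo `n`. -/
def cyclotomicCoset (q n x : ℕ) : Set ℕ := {t | ∃ i : ℕ, t = x * q ^ i % n}

/-- The cyclic code of length `n` over `F` with defining set `T`, with respect to the `n`-th root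
of unity `α`: the words `c` whose polynomial `c₀ + c₁ x + ⋯ + cₙ₋₁ xⁿ⁻¹` vanishes at `α ^ t` for
all `t ∈ T`. -/
def cyclicCode (F : Type*) [Field F] {E : Type*} [Field E] [Algebra F E] (n : ℕ) (α : E)
    (T : Set ℕ) : Submodule F (Fin n → F) where
  carrier := {c | ∀ t ∈ T, ∑ i : Fin n, algebraMap F E (c i) * (α ^ t) ^ (i : ℕ) = 0}
  zero_mem' := by
    intro t _
    simp
  add_mem' := by
    intro c c' hc hc' t ht
    simp only [Pi.add_apply, map_add, add_mul, Finset.sum_add_distrib]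
    rw [hc t ht, hc' t ht, add_zero]
  smul_mem' := by
    intro a c hc t ht
    simp only [Pi.smul_apply, smul_eq_mul, map_mul, mul_assoc, ← Finset.mul_sum]
    rw [hc t ht, mul_zero]

/-- `B` is a narrow-sense BCH code of length `n` over `F` with designed distance `δ`: the cyclic
code with defining set `C₁ ∪ ⋯ ∪ C_{δ-1}`, for some primitive `n`-th root of unity.
It is primitive if `n = q^m - 1`. -/
def IsNarrowSenseBCH {F : Type*} [Field F] [Fintype F] {n : ℕ} (δ : ℕ)
    (B : Submodule F (Fin n → F)) : Prop :=
  ∃ α : AlgebraicClosure F, IsPrimitiveRoot α n ∧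
    B = cyclicCode F n α (⋃ a ∈ Set.Ico 1 δ, cyclotomicCoset (Fintype.card F) n a)

/-- An `((n, K, R, d))_q` subsystem BCH code with designed distance `δ`: a Clifford subsystem code
derived from an additive code `C` such that `D = C ∩ C^⊥ₛ` satisfies
`D^⊥ₛ = {(a|b) : a, b ∈ B}` for a narrow-sense BCH code `B` with designed distance `δ`. -/
def IsSubsystemBCHCode (p : ℕ) [NeZero p] {F : Type*} [Field F] [Fintype F] [DecidableEq F]
    [Algebra (ZMod p) F] {n : ℕ} (δ K R d : ℕ)
    (U : Matrix (Fin n → F) (Fin K × Fin R) ℂ) : Prop :=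
  ∃ (B : Submodule F (Fin n → F)) (C : AddSubgroup ((Fin n → F) × (Fin n → F))),
    IsNarrowSenseBCH δ B ∧
    sympDual p (C ⊓ sympDual p C) = (B.prod B).toAddSubgroup ∧
    IsCliffordSubsystemCode p C K R d U

end

/-! Let `B` be the BCH code. The upper bound on `δ` enters only through (δ-1)(q^⌊m/2⌋+1) < n =
q^m-1. Since q^m ≡ 1 mod n, multiplying by q^(m-j) undoes multiplication by q^j; so a congruence
between numbers a q^j with 1 ≤ a < δ can be moved to exponents at most m/2, where all numbers
involved are below n and can be compared as integers. Two facts follow. The cosets of the a < δ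
prime to the relation q ∣ a are disjoint with m elements each (`card_bchDefiningSet`), which gives
the codimension of `B`. No zero of `B` is conjugate to the inverse of a zero
(`not_dvd_mul_pow_add`), so `B` contains its Euclidean dual N (`dotDual_le_of_forall_not_dvd`).

The dot product is then nondegenerate on B/N, which has dual bases `e`, `f` of size k + r. Let the
gauge code C consist of the pairs in B × B whose first k coordinates vanish. For every splitting k +
r, C ∩ C^⊥ₛ = N × N, whose symplectic dual is B × B, so r can be chosen freely. The normalized sums
over the cosets x + N, x ∈ B, span the code and are indexed by F^k × F^r: C acts on the second
factor as the full error group of F^r, and errors outside B × B compress to zero. Only errors in (B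
× B) \ C can go undetected; their least weight is d, and the BCH bound gives d ≥ δ. -/

noncomputable section

/-! ### Dual frames: coordinates on B/N -/

/-- For subspaces `N ≤ B = N^⊥` of `F^n`, two families `e`, `f` in `B` that induce mutually dual
bases of `B / N` for the dot product. -/
structure IsDualFrame {F : Type*} [Field F] {n : ℕ} (N B : Submodule F (Fin n → F))
    {σ : Type*} [DecidableEq σ] (e f : σ → Fin n → F) : Prop where
  le : N ≤ B
  mem_iff : ∀ x, x ∈ B ↔ ∀ y ∈ N, y ⬝ᵥ x = 0
  left_mem : ∀ s, e s ∈ B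
  right_mem : ∀ s, f s ∈ B
  dot : ∀ s t, e s ⬝ᵥ f t = if s = t then 1 else 0
  mem_of_right : ∀ x ∈ B, (∀ s, x ⬝ᵥ f s = 0) → x ∈ N
  mem_of_left : ∀ x ∈ B, (∀ s, x ⬝ᵥ e s = 0) → x ∈ N

namespace IsDualFrame

variable {F : Type*} [Field F] {n : ℕ} {N B : Submodule F (Fin n → F)}
  {σ : Type*} [DecidableEq σ] {e f : σ → Fin n → F}

theorem symm (h : IsDualFrame N B e f) : IsDualFrame N B f e where
  le := h.le
  mem_iff := h.mem_iff
  left_mem := h.right_mem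
  right_mem := h.left_mem
  dot s t := by
    rw [dotProduct_comm, h.dot]
    simp only [eq_comm]
  mem_of_right := h.mem_of_left
  mem_of_left := h.mem_of_right

theorem dot_eq_zero (h : IsDualFrame N B e f) {x y : Fin n → F} (hx : x ∈ N) (hy : y ∈ B) :
    x ⬝ᵥ y = 0 := (h.mem_iff y).1 hy x hx

variable [Fintype σ]

theorem sum_mem (h : IsDualFrame N B e f) (u : σ → F) : ∑ s, u s • e s ∈ B :=
  Submodule.sum_mem _ fun s _ => Submodule.smul_mem _ _ (h.left_mem s)

theorem sum_dot (h : IsDualFrame N B e f) (u : σ → F) (t : σ) :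
    (∑ s, u s • e s) ⬝ᵥ f t = u t := by
  simp [sum_dotProduct, h.dot]

theorem sub_sum_mem (h : IsDualFrame N B e f) {x : Fin n → F} (hx : x ∈ B) {u : σ → F}
    (hu : ∀ s, x ⬝ᵥ f s = u s) : x - ∑ s, u s • e s ∈ N := by
  refine h.mem_of_right _ (Submodule.sub_mem _ hx (h.sum_mem u)) fun s => ?_
  rw [sub_dotProduct, h.sum_dot, hu, sub_self]

/-- Modulo N, which is orthogonal to B, the vector x equals the combination of the `e s` with its
coordinates; hence the dot product on B depends on coordinates only. -/
theorem dot_eq_sum (h : IsDualFrame N B e f) {x y : Fin n → F} (hx : x ∈ B) (hy : y ∈ B) :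
    x ⬝ᵥ y = ∑ s, (x ⬝ᵥ f s) * (y ⬝ᵥ e s) := by
  have h1 := h.dot_eq_zero (h.sub_sum_mem hx fun s => rfl) hy
  rw [sub_dotProduct, sub_eq_zero] at h1
  rw [h1, sum_dotProduct]
  refine Finset.sum_congr rfl fun s _ => ?_
  rw [smul_dotProduct, dotProduct_comm (e s), smul_eq_mul]

/-- The vectors of `B` with prescribed coordinates form a coset of `N`. -/
def fiberEquiv (h : IsDualFrame N B e f) (u : σ → F) :
    {x : Fin n → F // x ∈ B ∧ ∀ s, x ⬝ᵥ f s = u s} ≃ N where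
  toFun x := ⟨x.1 - ∑ s, u s • e s, h.sub_sum_mem x.2.1 x.2.2⟩
  invFun y := ⟨y.1 + ∑ s, u s • e s, Submodule.add_mem _ (h.le y.2) (h.sum_mem u), fun s => by
    rw [add_dotProduct, h.sum_dot, h.dot_eq_zero y.2 (h.right_mem s), zero_add]⟩
  left_inv x := by simp
  right_inv y := by simp

theorem coe_fiberEquiv (h : IsDualFrame N B e f) (u : σ → F)
    (x : {x : Fin n → F // x ∈ B ∧ ∀ s, x ⬝ᵥ f s = u s}) :
    (h.fiberEquiv u x : Fin n → F) = x.1 - ∑ s, u s • e s := rfl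

theorem coe_fiberEquiv_symm (h : IsDualFrame N B e f) (u : σ → F) (y : N) :
    ((h.fiberEquiv u).symm y : Fin n → F) = y.1 + ∑ s, u s • e s := rfl

end IsDualFrame

/-- The vectors of `B` that are orthogonal to the family `f`. -/
def orthIn {F : Type*} [Field F] {n : ℕ} (B : Submodule F (Fin n → F)) {ι : Type*}
    (f : ι → Fin n → F) : Submodule F (Fin n → F) where
  carrier := {x | x ∈ B ∧ ∀ i, x ⬝ᵥ f i = 0}
  zero_mem' := ⟨B.zero_mem, by simp⟩
  add_mem' := fun hx hy => ⟨B.add_mem hx.1 hy.1, fun i => by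
    rw [add_dotProduct, hx.2, hy.2, add_zero]⟩
  smul_mem' := fun a x hx => ⟨B.smul_mem a hx.1, fun i => by
    rw [smul_dotProduct, hx.2, smul_zero]⟩

namespace IsDualFrame

variable {F : Type*} [Field F] {n : ℕ} {N B : Submodule F (Fin n → F)}
  {ι κ : Type*} [DecidableEq ι] [DecidableEq κ] {e f : ι ⊕ κ → Fin n → F}

theorem le_orthIn (h : IsDualFrame N B e f) : N ≤ orthIn B (f ∘ Sum.inl) :=
  fun _ hx => ⟨h.le hx, fun i => h.dot_eq_zero hx (h.right_mem (Sum.inl i))⟩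

theorem right_mem_orthIn (h : IsDualFrame N B e f) (k : κ) :
    e (Sum.inr k) ∈ orthIn B (f ∘ Sum.inl) :=
  ⟨h.left_mem _, fun i => by simp [h.dot]⟩

variable [Fintype ι] [Fintype κ]

/-- The vectors of `B` whose first coordinates vanish are given by a vector of `N` and the
remaining coordinates. -/
def orthInEquiv (h : IsDualFrame N B e f) :
    orthIn B (f ∘ Sum.inl) ≃ (κ → F) × N where
  toFun x := ⟨fun k => x.1 ⬝ᵥ f (Sum.inr k),
    h.fiberEquiv (Sum.elim 0 fun k => x.1 ⬝ᵥ f (Sum.inr k)) ⟨x.1, x.2.1, by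
      rintro (i | k)
      · exact x.2.2 i
      · rfl⟩⟩
  invFun y := ⟨((h.fiberEquiv (Sum.elim 0 y.1)).symm y.2).1,
    ((h.fiberEquiv (Sum.elim 0 y.1)).symm y.2).2.1,
    fun i => ((h.fiberEquiv (Sum.elim 0 y.1)).symm y.2).2.2 (Sum.inl i)⟩
  left_inv x := by simp
  right_inv := by
    rintro ⟨u, y⟩
    have h1 : (fun k => ((h.fiberEquiv (Sum.elim 0 u)).symm y).1 ⬝ᵥ f (Sum.inr k)) = u :=
      funext fun k => ((h.fiberEquiv (Sum.elim 0 u)).symm y).2.2 (Sum.inr k)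
    ext : 1
    · exact h1
    · refine Subtype.ext ((h.coe_fiberEquiv _ _).trans ?_)
      simp only [coe_fiberEquiv_symm] at h1 ⊢
      rw [h1, add_sub_cancel_right]

theorem card_orthIn [Finite F] (h : IsDualFrame N B e f) :
    Nat.card (orthIn B (f ∘ Sum.inl)) = Nat.card F ^ Fintype.card κ * Nat.card N := by
  rw [Nat.card_congr h.orthInEquiv, Nat.card_prod, Nat.card_fun, Nat.card_eq_fintype_card (α := κ)]

end IsDualFrame

/-! ### Trace-symplectic duals and the gauge code -/

section SymplecticDual

variable {p : ℕ} [Fact p.Prime] {F : Type*} [Field F] [Finite F] [Algebra (ZMod p) F] {n : ℕ}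

/-- By nondegeneracy of the trace form, trace conditions on all scalar multiples amount to
conditions over `F`. This reduces symplectic duality of linear codes to Euclidean orthogonality. -/
theorem exists_trace_smul_dot_ne_zero {x y : Fin n → F} (h : x ⬝ᵥ y ≠ 0) :
    ∃ a : F, Algebra.trace (ZMod p) F (x ⬝ᵥ (a • y)) ≠ 0 := by
  have := traceForm_nondegenerate (ZMod p) F
  by_contra! hc
  refine h (this.1 _ fun a => ?_)
  have := hc a
  rwa [dotProduct_smul, smul_eq_mul, mul_comm] at this

theorem mem_sympDual_prod {X Y : Submodule F (Fin n → F)} {v : (Fin n → F) × (Fin n → F)} :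
    v ∈ sympDual p (X.prod Y).toAddSubgroup ↔
      (∀ y ∈ Y, v.1 ⬝ᵥ y = 0) ∧ ∀ x ∈ X, v.2 ⬝ᵥ x = 0 := by
  constructor
  · intro hv
    refine ⟨fun y hy => ?_, fun x hx => ?_⟩
    · by_contra hne
      obtain ⟨a, ha⟩ := exists_trace_smul_dot_ne_zero (p := p) hne
      apply ha
      have := hv (0, a • y) ⟨X.zero_mem, Y.smul_mem a hy⟩
      simpa [traceSymp] using this
    · by_contra hne
      obtain ⟨a, ha⟩ := exists_trace_smul_dot_ne_zero (p := p) hne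
      apply ha
      have := hv (a • x, 0) ⟨X.smul_mem a hx, Y.zero_mem⟩
      simpa [traceSymp, dotProduct_comm] using this
  · rintro ⟨h1, h2⟩ w ⟨hw1, hw2⟩
    rw [traceSymp, h1 _ hw2, dotProduct_comm, h2 _ hw1, sub_zero, map_zero]

theorem sum_stdAddChar_trace_smul_dot {x y : Fin n → F}
    {S : Submodule F (Fin n → F)} (hy : y ∈ S) (h : x ⬝ᵥ y ≠ 0) [Fintype S] :
    ∑ z : S, ZMod.stdAddChar (N := p) (Algebra.trace (ZMod p) F (x ⬝ᵥ z.1)) = 0 := by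
  let ψ : AddChar S ℂ :=
    { toFun := fun z => ZMod.stdAddChar (N := p) (Algebra.trace (ZMod p) F (x ⬝ᵥ z.1))
      map_zero_eq_one' := by simp
      map_add_eq_mul' := fun z w => by
        simp [dotProduct_add, AddChar.map_add_eq_mul] }
  refine AddChar.sum_eq_zero_of_ne_one (ψ := ψ) fun hψ => ?_
  obtain ⟨a, ha⟩ := exists_trace_smul_dot_ne_zero (p := p) h
  refine ha (ZMod.injective_stdAddChar ?_)
  rw [AddChar.map_zero_eq_one]
  exact DFunLike.congr_fun hψ (⟨a • y, S.smul_mem a hy⟩ : S)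

variable {N B : Submodule F (Fin n → F)} {ι κ : Type*} [DecidableEq ι] [DecidableEq κ]
  {e f : ι ⊕ κ → Fin n → F}

/-- The gauge code of a dual frame: the vectors of `B × B` whose first coordinates vanish. -/
def gaugeCode (B : Submodule F (Fin n → F)) (e f : ι ⊕ κ → Fin n → F) :
    AddSubgroup ((Fin n → F) × (Fin n → F)) :=
  ((orthIn B (f ∘ Sum.inl)).prod (orthIn B (e ∘ Sum.inl))).toAddSubgroup

/-- Membership in the gauge code kills the first coordinates. The remaining basis vectors lie in the
gauge code themselves, so membership in its dual kills the other coordinates and leaves N. -/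
theorem gaugeCode_inf_sympDual [Fintype ι] [Fintype κ] (h : IsDualFrame N B e f) :
    gaugeCode B e f ⊓ sympDual p (gaugeCode B e f) = (N.prod N).toAddSubgroup := by
  ext v
  rw [AddSubgroup.mem_inf, gaugeCode, mem_sympDual_prod]
  constructor
  · rintro ⟨⟨h1, h2⟩, h3, h4⟩
    refine ⟨h.mem_of_right _ h1.1 ?_, h.mem_of_left _ h2.1 ?_⟩
    · rintro (i | k)
      · exact h1.2 i
      · exact h3 _ (h.symm.right_mem_orthIn k)
    · rintro (i | k)
      · exact h2.2 i
      · exact h4 _ (h.right_mem_orthIn k)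
  · rintro ⟨h1, h2⟩
    exact ⟨⟨h.le_orthIn h1, h.symm.le_orthIn h2⟩, fun y hy => h.dot_eq_zero h1 hy.1,
      fun x hx => h.dot_eq_zero h2 hx.1⟩

theorem sympDual_prod_self (h : IsDualFrame N B e f) :
    sympDual p (N.prod N).toAddSubgroup = (B.prod B).toAddSubgroup := by
  ext v
  rw [mem_sympDual_prod]
  refine and_congr ?_ ?_ <;>
  · rw [SetLike.mem_coe, h.mem_iff]
    simp only [dotProduct_comm]

end SymplecticDual

/-! ### Error operators and irreducibility -/

section Operators

variable {p : ℕ} [Fact p.Prime] {F : Type*} [Field F] [DecidableEq F]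
  [Algebra (ZMod p) F] {n : ℕ}

theorem errorOp_mul_apply [Fintype F] {β : Type*} (v : (Fin n → F) × (Fin n → F))
    (A : Matrix (Fin n → F) β ℂ) (y : Fin n → F) (j : β) :
    (errorOp p v * A) y j =
      ZMod.stdAddChar (Algebra.trace (ZMod p) F (v.2 ⬝ᵥ (y - v.1))) * A (y - v.1) j := by
  rw [Matrix.mul_apply, Finset.sum_eq_single (y - v.1)]
  · simp [errorOp]
  · intro x _ hx
    rw [errorOp, Matrix.of_apply, if_neg, zero_mul]
    rintro rfl
    simp at hx
  · simp

theorem mul_one_kronecker_errorOp_apply {γ α β : Type*} [Fintype α] [DecidableEq α] [Fintype β]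
    (b : β ≃ (Fin n → F)) (U : Matrix γ (α × β) ℂ)
    (v : (Fin n → F) × (Fin n → F)) (y : γ) (i : α) (j : β) :
    (U * ((1 : Matrix α α ℂ) ⊗ₖ (errorOp p v).submatrix b b)) y (i, j) =
      U y (i, b.symm (b j + v.1)) *
        ZMod.stdAddChar (Algebra.trace (ZMod p) F (v.2 ⬝ᵥ b j)) := by
  rw [Matrix.mul_apply, Finset.sum_eq_single (i, b.symm (b j + v.1))]
  · simp [errorOp]
  · rintro ⟨i', j'⟩ _ hne
    rw [Matrix.kroneckerMap_apply, Matrix.submatrix_apply, errorOp, Matrix.of_apply]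
    by_cases hi : i' = i
    · rw [if_neg, mul_zero, mul_zero]
      intro hj
      exact hne (by rw [hi, ← hj, Equiv.symm_apply_apply])
    · simp [Matrix.one_apply_ne hi]
  · simp

theorem errorOp_submatrix_mulVec {β : Type*} [Fintype β] (b : β ≃ (Fin n → F))
    (v : (Fin n → F) × (Fin n → F)) (w : β → ℂ) (j : β) :
    ((errorOp p v).submatrix b b *ᵥ w) j =
      ZMod.stdAddChar (Algebra.trace (ZMod p) F (v.2 ⬝ᵥ (b j - v.1))) *
        w (b.symm (b j - v.1)) := by
  rw [Matrix.mulVec, dotProduct, Finset.sum_eq_single (b.symm (b j - v.1))]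
  · simp [errorOp]
  · intro x _ hx
    rw [Matrix.submatrix_apply, errorOp, Matrix.of_apply, if_neg, zero_mul]
    intro hj
    exact hx (by rw [hj, add_sub_cancel_right, Equiv.symm_apply_apply])
  · simp

/-- The error operators act irreducibly. -/
theorem errorOp_irreducible [Fintype F] {β : Type*} [Fintype β] [DecidableEq β]
    (b : β ≃ (Fin n → F)) (W : Submodule ℂ (β → ℂ))
    (hW : ∀ v, ∀ w ∈ W, (errorOp p v).submatrix b b *ᵥ w ∈ W) : W = ⊥ ∨ W = ⊤ := by
  rw [or_iff_not_imp_left]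
  intro hne
  obtain ⟨w, hw, hw0⟩ := Submodule.exists_mem_ne_zero_of_ne_bot hne
  obtain ⟨j₀, hj₀⟩ := Function.ne_iff.1 hw0
  have h1 : (Pi.single j₀ 1 : β → ℂ) ∈ W := by
    -- Averaging the phase errors Z(c) against the character of `b j₀` projects `w` onto the basis
    -- vector at `j₀`, up to the factor q^n.
    have h2 : ∑ c : Fin n → F,
        ZMod.stdAddChar (N := p) (Algebra.trace (ZMod p) F (-(c ⬝ᵥ b j₀))) •
          ((errorOp p (0, c)).submatrix b b *ᵥ w) ∈ W :=
      Submodule.sum_mem _ fun c _ => Submodule.smul_mem _ _ (hW _ w hw)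
    have h3 : ∑ c : Fin n → F,
        ZMod.stdAddChar (N := p) (Algebra.trace (ZMod p) F (-(c ⬝ᵥ b j₀))) •
          ((errorOp p (0, c)).submatrix b b *ᵥ w) =
        ((Fintype.card (Fin n → F) : ℂ) * w j₀) • (Pi.single j₀ 1 : β → ℂ) := by
      ext j
      simp only [Finset.sum_apply, Pi.smul_apply, errorOp_submatrix_mulVec, smul_eq_mul, sub_zero,
        Equiv.symm_apply_apply, ← mul_assoc, ← AddChar.map_add_eq_mul, ← map_add]
      rw [← Finset.sum_mul]
      by_cases hj : j = j₀
      · subst hj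
        simp
      · have hb : b j - b j₀ ≠ 0 := fun h0 => hj (b.injective (sub_eq_zero.1 h0))
        obtain ⟨k, hk⟩ := Function.ne_iff.1 hb
        have : Fintype (⊤ : Submodule F (Fin n → F)) := Fintype.ofFinite _
        have h4 := sum_stdAddChar_trace_smul_dot (p := p) (x := b j - b j₀)
          (y := Pi.single k 1) (S := ⊤) trivial (by simpa using hk)
        rw [← Equiv.sum_comp (Equiv.subtypeUnivEquiv (fun _ => Submodule.mem_top)).symm] at h4
        rw [Pi.single_eq_of_ne hj, mul_zero]
        refine mul_eq_zero_of_left (Eq.trans (Finset.sum_congr rfl fun c _ => ?_) h4) _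
        congr 2
        rw [Equiv.subtypeUnivEquiv_symm_apply, sub_dotProduct, dotProduct_comm c,
          dotProduct_comm c, neg_add_eq_sub]
    rw [h3] at h2
    refine (Submodule.smul_mem_iff _ (mul_ne_zero ?_ hj₀)).1 h2
    exact Nat.cast_ne_zero.2 Fintype.card_ne_zero
  -- The shifts X(a) carry one basis vector to every other.
  have h5 : ∀ j, (Pi.single j 1 : β → ℂ) ∈ W := by
    intro j
    have h6 := hW (b j - b j₀, 0) _ h1
    convert h6 using 1
    ext k
    rw [errorOp_submatrix_mulVec]
    simp only [zero_dotProduct, map_zero, AddChar.map_zero_eq_one, one_mul, Pi.single_apply]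
    congr 1
    rw [Equiv.symm_apply_eq, eq_iff_iff]
    constructor
    · rintro rfl
      abel
    · intro h7
      apply b.injective
      linear_combination (exp := 1) h7
  rw [eq_top_iff]
  intro x _
  rw [pi_eq_sum_univ' x]
  exact Submodule.sum_mem _ fun j _ => Submodule.smul_mem _ _ (h5 j)

end Operators

/-! ### The encoder by coset states -/

section Encoding

open Classical in
/-- The encoder of the CSS subsystem code of a dual frame: the basis vector `|i⟩ ⊗ |j⟩` is sent to
the normalized sum of all `|x⟩` where `x ∈ B` has the coordinates given by `i` and `j`. -/
def cssEncoder {F : Type*} [Field F] {n : ℕ} (N B : Submodule F (Fin n → F))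
    {ι κ α β : Type*} (f : ι ⊕ κ → Fin n → F) (a : α ≃ (ι → F)) (b : β ≃ (κ → F)) :
    Matrix (Fin n → F) (α × β) ℂ :=
  Matrix.of fun x ij =>
    if x ∈ B ∧ ∀ s, x ⬝ᵥ f s = Sum.elim (a ij.1) (b ij.2) s then ((√(Nat.card N) : ℝ) : ℂ)⁻¹
    else 0

variable {p : ℕ} [Fact p.Prime] {F : Type*} [Field F] [Fintype F] {n : ℕ}
  {N B : Submodule F (Fin n → F)} {ι α β : Type*} [Fintype ι] [DecidableEq ι]

theorem cssEncoder_conjTranspose_mul_self {κ : Type*} [Fintype κ] [DecidableEq κ]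
    [DecidableEq α] [DecidableEq β] {e f : ι ⊕ κ → Fin n → F}
    (h : IsDualFrame N B e f) (a : α ≃ (ι → F)) (b : β ≃ (κ → F)) :
    (cssEncoder N B f a b)ᴴ * cssEncoder N B f a b = 1 := by
  classical
  ext ij ij'
  have h1 : ∀ x, (cssEncoder N B f a b)ᴴ ij x * cssEncoder N B f a b x ij' =
      if (x ∈ B ∧ ∀ s, x ⬝ᵥ f s = Sum.elim (a ij.1) (b ij.2) s) ∧ ij = ij' then
        (Nat.card N : ℂ)⁻¹ else 0 := by
    intro x
    rw [Matrix.conjTranspose_apply, cssEncoder, Matrix.of_apply, Matrix.of_apply]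
    by_cases hx : x ∈ B ∧ ∀ s, x ⬝ᵥ f s = Sum.elim (a ij.1) (b ij.2) s
    · by_cases hij : ij = ij'
      · subst hij
        rw [if_pos hx, if_pos ⟨hx, rfl⟩, star_inv₀, ← mul_inv, Complex.star_def,
          Complex.conj_ofReal, ← Complex.ofReal_mul, Real.mul_self_sqrt (Nat.cast_nonneg _),
          Complex.ofReal_natCast]
      · rw [if_pos hx, if_neg (c := _ ∧ ij = ij') fun hc => hij hc.2, if_neg, mul_zero]
        rintro ⟨-, hx'⟩
        refine hij (Prod.ext (a.injective (funext fun i => ?_)) (b.injective (funext fun k => ?_)))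
        · exact (hx.2 (Sum.inl i)).symm.trans (hx' (Sum.inl i))
        · exact (hx.2 (Sum.inr k)).symm.trans (hx' (Sum.inr k))
    · rw [if_neg hx, if_neg (c := _ ∧ ij = ij') fun hc => hx hc.1, star_zero, zero_mul]
  rw [Matrix.mul_apply, Finset.sum_congr rfl fun x _ => h1 x]
  by_cases hij : ij = ij'
  · subst hij
    simp only [and_true, Matrix.one_apply_eq]
    rw [← Finset.sum_filter, Finset.sum_const, nsmul_eq_mul, ← Fintype.card_subtype,
      ← Nat.card_eq_fintype_card, Nat.card_congr (h.fiberEquiv _)]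
    exact mul_inv_cancel₀ (Nat.cast_ne_zero.2 Nat.card_pos.ne')
  · simp [hij]

variable [DecidableEq F] [Algebra (ZMod p) F] {r : ℕ} {e f : ι ⊕ Fin r → Fin n → F}

/-- The errors of the gauge code act on the second tensor factor only. -/
theorem errorOp_mul_cssEncoder [Fintype α] [DecidableEq α] [Fintype β]
    (h : IsDualFrame N B e f) (a : α ≃ (ι → F))
    (b : β ≃ (Fin r → F)) {c : (Fin n → F) × (Fin n → F)} (hc : c ∈ gaugeCode B e f) :
    errorOp p c * cssEncoder N B f a b = cssEncoder N B f a b * ((1 : Matrix α α ℂ) ⊗ₖ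
      (errorOp p (fun k => c.1 ⬝ᵥ f (Sum.inr k), fun k => c.2 ⬝ᵥ e (Sum.inr k))).submatrix b b) := by
  obtain ⟨⟨hc1, hcf⟩, hc2, hce⟩ := hc
  ext y ⟨i, j⟩
  rw [errorOp_mul_apply, mul_one_kronecker_errorOp_apply, mul_comm]
  simp only [cssEncoder, Matrix.of_apply, ite_mul, zero_mul]
  have hiff : (y - c.1 ∈ B ∧ ∀ s, (y - c.1) ⬝ᵥ f s = Sum.elim (a i) (b j) s) ↔
      (y ∈ B ∧ ∀ s, y ⬝ᵥ f s = Sum.elim (a i) (b (b.symm (b j +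
        fun k => c.1 ⬝ᵥ f (Sum.inr k)))) s) := by
    refine and_congr (Submodule.sub_mem_iff_left _ hc1) ?_
    simp only [Sum.forall, sub_dotProduct, Sum.elim_inl, Sum.elim_inr, Equiv.apply_symm_apply,
      Pi.add_apply, sub_eq_iff_eq_add]
    refine and_congr_left fun _ => forall_congr' fun i' => ?_
    rw [show c.1 ⬝ᵥ f (Sum.inl i') = 0 from hcf i', add_zero]
  by_cases hx : y - c.1 ∈ B ∧ ∀ s, (y - c.1) ⬝ᵥ f s = Sum.elim (a i) (b j) s
  · rw [if_pos hx, if_pos (hiff.1 hx)]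
    congr 3
    -- The phase splits into coordinates; those of `c.2` in the first block vanish, so it depends on
    -- `j` alone.
    rw [dotProduct_comm, h.dot_eq_sum hx.1 hc2, Fintype.sum_sum_type, Finset.sum_eq_zero, zero_add]
    · rw [dotProduct_comm, dotProduct]
      exact Finset.sum_congr rfl fun k _ => by rw [hx.2, Sum.elim_inr]
    · intro i' _
      rw [show c.2 ⬝ᵥ e (Sum.inl i') = 0 from hce i', mul_zero]
  · rw [if_neg hx, if_neg fun hc => hx (hiff.2 hc)]

/-- The errors outside of `B × B` are detected by the code. -/
theorem conjTranspose_mul_errorOp_mul_cssEncoder (h : IsDualFrame N B e f) (a : α ≃ (ι → F))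
    (b : β ≃ (Fin r → F)) {v : (Fin n → F) × (Fin n → F)} (hv : ¬ (v.1 ∈ B ∧ v.2 ∈ B)) :
    (cssEncoder N B f a b)ᴴ * errorOp p v * cssEncoder N B f a b = 0 := by
  classical
  ext ij ij'
  rw [Matrix.mul_assoc, Matrix.mul_apply, Matrix.zero_apply]
  simp only [errorOp_mul_apply, Matrix.conjTranspose_apply]
  by_cases hv1 : v.1 ∈ B
  · have hv2 : v.2 ∉ B := fun h2 => hv ⟨hv1, h2⟩
    rw [h.mem_iff] at hv2
    push Not at hv2
    obtain ⟨z, hz, hz0⟩ := hv2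
    rw [dotProduct_comm] at hz0
    have hshift : ∀ z' ∈ N, ∀ y ij,
        cssEncoder N B f a b (y + z') ij = cssEncoder N B f a b y ij := by
      intro z' hz' y ij
      simp only [cssEncoder, Matrix.of_apply, add_dotProduct,
        Submodule.add_mem_iff_left _ (h.le hz'), h.dot_eq_zero hz' (h.right_mem _), add_zero]
      congr
    -- The code states are invariant under translation by N, so translating the summation variable
    -- only multiplies the entry by a phase. Since `v.2` is not orthogonal to N, these phases sum to
    -- zero over N.
    have key : ∀ z' : N, ∑ x, star (cssEncoder N B f a b x ij) *
        (ZMod.stdAddChar (Algebra.trace (ZMod p) F (v.2 ⬝ᵥ (x - v.1))) *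
          cssEncoder N B f a b (x - v.1) ij') =
        ZMod.stdAddChar (Algebra.trace (ZMod p) F (v.2 ⬝ᵥ z'.1)) *
        ∑ x, star (cssEncoder N B f a b x ij) *
        (ZMod.stdAddChar (Algebra.trace (ZMod p) F (v.2 ⬝ᵥ (x - v.1))) *
          cssEncoder N B f a b (x - v.1) ij') := by
      intro z'
      rw [Finset.mul_sum]
      refine (Equiv.sum_comp (Equiv.addRight z'.1) _).symm.trans ?_
      refine Finset.sum_congr rfl fun x _ => ?_
      rw [Equiv.coe_addRight, hshift _ z'.2, add_sub_right_comm, hshift _ z'.2, dotProduct_add,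
        map_add, AddChar.map_add_eq_mul]
      ring
    have hsum := Finset.sum_congr (s₁ := (Finset.univ : Finset N)) rfl fun z' _ => key z'
    rw [← Finset.sum_mul, sum_stdAddChar_trace_smul_dot hz hz0, zero_mul, Finset.sum_const,
      smul_eq_zero] at hsum
    exact hsum.resolve_left (Finset.card_ne_zero.2 Finset.univ_nonempty)
  -- A shift by `v.1` outside B moves the supports of the code states off B.
  · refine Finset.sum_eq_zero fun x _ => ?_
    simp only [cssEncoder, Matrix.of_apply]
    by_cases hx : x ∈ B
    · rw [if_neg (c := x - v.1 ∈ B ∧ _), mul_zero, mul_zero]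
      rintro ⟨hx', -⟩
      exact hv1 (by simpa using Submodule.sub_mem _ hx hx')
    · rw [if_neg fun hc => hx hc.1, star_zero, zero_mul]

end Encoding

/-! ### The CSS construction -/

theorem card_prod_toAddSubgroup {F V : Type*} [Ring F] [AddCommGroup V] [Module F V]
    (X Y : Submodule F V) : Nat.card (X.prod Y).toAddSubgroup = Nat.card X * Nat.card Y := by
  rw [← Nat.card_prod]
  exact Nat.card_congr (Equiv.Set.prod (X : Set V) (Y : Set V))

/-- The CSS construction: a dual frame yields a Clifford subsystem code. -/
theorem IsDualFrame.isCliffordSubsystemCode {p : ℕ} [Fact p.Prime] {F : Type*} [Field F]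
    [Fintype F] [DecidableEq F] [Algebra (ZMod p) F] {n k r K R d : ℕ}
    {N B : Submodule F (Fin n → F)} {e f : Fin k ⊕ Fin r → Fin n → F}
    (h : IsDualFrame N B e f) (hN : N ≠ ⊥)
    (hn : k + r + 2 * Module.finrank F N = n) (hK : K = Fintype.card F ^ k)
    (hR : R = Fintype.card F ^ r) (a : Fin K ≃ (Fin k → F)) (b : Fin R ≃ (Fin r → F))
    (hd : IsLeast {w | ∃ v ∈ (B.prod B).toAddSubgroup, v ∉ gaugeCode B e f ∧ sympWeight v = w} d) :
    IsCliffordSubsystemCode p (gaugeCode B e f) K R d (cssEncoder N B f a b) := by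
  have hdual : sympDual p (gaugeCode B e f ⊓ sympDual p (gaugeCode B e f)) =
      (B.prod B).toAddSubgroup := by
    rw [gaugeCode_inf_sympDual h, sympDual_prod_self h]
  have hNcard : Nat.card N = Fintype.card F ^ Module.finrank F N := by
    rw [Module.natCard_eq_pow_finrank (K := F), Nat.card_eq_fintype_card]
  refine ⟨⟨cssEncoder_conjTranspose_mul_self h a b, fun v hv => ?_⟩, ?_, ?_, ?_, ?_, ?_, ?_⟩
  · by_cases hvB : v.1 ∈ B ∧ v.2 ∈ B
    · have hvC : v ∈ gaugeCode B e f := by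
        by_contra hvC
        exact (hd.2 ⟨v, hvB, hvC, rfl⟩).not_gt hv
      refine ⟨(errorOp p (fun k => v.1 ⬝ᵥ f (Sum.inr k),
        fun k => v.2 ⬝ᵥ e (Sum.inr k))).submatrix b b, ?_⟩
      rw [Matrix.mul_assoc, errorOp_mul_cssEncoder h a b hvC, ← Matrix.mul_assoc,
        cssEncoder_conjTranspose_mul_self h, Matrix.one_mul]
    · exact ⟨0, by rw [conjTranspose_mul_errorOp_mul_cssEncoder h a b hvB, Matrix.kronecker_zero]⟩
  · obtain ⟨x, hx, hx0⟩ := Submodule.exists_mem_ne_zero_of_ne_bot hN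
    intro hbot
    have hxC : ((x, 0) : (Fin n → F) × (Fin n → F)) ∈ gaugeCode B e f :=
      ⟨h.le_orthIn hx, Submodule.zero_mem _⟩
    rw [hbot, AddSubgroup.mem_bot, Prod.mk_eq_zero] at hxC
    exact hx0 hxC.1
  · have hcard : Nat.card (gaugeCode B e f) =
        Nat.card (orthIn B (f ∘ Sum.inl)) * Nat.card (orthIn B (e ∘ Sum.inl)) :=
      card_prod_toAddSubgroup _ _
    rw [hcard, h.card_orthIn, h.symm.card_orthIn, hNcard, hK, hR, Nat.card_eq_fintype_card,
      Fintype.card_fin]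
    simp only [← pow_add]
    congr 1
    omega
  · rw [gaugeCode_inf_sympDual h]
    rw [card_prod_toAddSubgroup, hNcard, hK, hR]
    simp only [← pow_add]
    congr 1
    omega
  · refine ⟨_, fun c hc => errorOp_mul_cssEncoder h a b hc, fun W hW =>
      errorOp_irreducible (p := p) b W fun v w hw => ?_⟩
    -- Every error on F^r is induced by a gauge vector: use its entries as the last coordinates and
    -- zeros as the first.
    have hmem : (∑ s, Sum.elim (0 : Fin k → F) v.1 s • e s,
        ∑ s, Sum.elim (0 : Fin k → F) v.2 s • f s) ∈ gaugeCode B e f :=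
      ⟨⟨h.sum_mem _, fun i => h.sum_dot _ _⟩, h.symm.sum_mem _, fun i => h.symm.sum_dot _ _⟩
    have := hW _ hmem w hw
    simpa only [h.sum_dot, h.symm.sum_dot, Sum.elim_inr] using this
  · intro _
    rw [hdual]
    exact hd
  -- This case is void, because `d` is attained outside the gauge code.
  · intro heq
    rw [hdual] at heq
    obtain ⟨v, hvB, hvC, -⟩ := hd.1
    exact absurd (heq ▸ hvB) hvC

/-- A vector of `B × B` outside of the gauge code exists if the first tensor factor is not
trivial. -/
theorem IsDualFrame.exists_notMem_gaugeCode {F : Type*} [Field F] {n k r : ℕ}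
    {N B : Submodule F (Fin n → F)} {e f : Fin k ⊕ Fin r → Fin n → F}
    (h : IsDualFrame N B e f) (hk : k ≠ 0) :
    ∃ v ∈ (B.prod B).toAddSubgroup, v ∉ gaugeCode B e f := by
  refine ⟨(e (Sum.inl ⟨0, Nat.pos_of_ne_zero hk⟩), 0), ⟨h.left_mem _, B.zero_mem⟩, fun hc => ?_⟩
  have := hc.1.2 ⟨0, Nat.pos_of_ne_zero hk⟩
  simp [h.dot] at this

/-! ### Euclidean duals and existence of dual frames -/

theorem dotProductBilin_nondegenerate (F : Type*) [Field F] (n : ℕ) :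
    LinearMap.BilinForm.Nondegenerate (dotProductBilin F F : LinearMap.BilinForm F (Fin n → F)) :=
  ⟨fun x hx => dotProduct_eq_zero x hx,
    fun x hx => dotProduct_eq_zero x fun y => by rw [dotProduct_comm]; exact hx y⟩

theorem dotProductBilin_isSymm (F : Type*) [Field F] (n : ℕ) :
    LinearMap.BilinForm.IsSymm (dotProductBilin F F : LinearMap.BilinForm F (Fin n → F)) :=
  ⟨fun x y => dotProduct_comm x y⟩

/-- The Euclidean dual of a linear code. -/
def dotDual {F : Type*} [Field F] {n : ℕ} (B : Submodule F (Fin n → F)) :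
    Submodule F (Fin n → F) :=
  LinearMap.BilinForm.orthogonal (dotProductBilin F F) B

section DotDual

variable {F : Type*} [Field F] {n : ℕ} {B : Submodule F (Fin n → F)}

theorem mem_dotDual {x : Fin n → F} : x ∈ dotDual B ↔ ∀ y ∈ B, y ⬝ᵥ x = 0 := Iff.rfl

theorem dotDual_dotDual : dotDual (dotDual B) = B :=
  LinearMap.BilinForm.orthogonal_orthogonal (dotProductBilin_nondegenerate F n)
    (dotProductBilin_isSymm F n).isRefl B

theorem finrank_dotDual_add : Module.finrank F (dotDual B) + Module.finrank F B = n := by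
  have h1 := LinearMap.BilinForm.finrank_orthogonal (dotProductBilin_nondegenerate F n) B
  have h2 := Submodule.finrank_le B
  rw [Module.finrank_fin_fun] at h1 h2
  rw [dotDual, h1]
  omega

/-- A code that contains its dual has a dual frame. -/
theorem exists_isDualFrame (hB : dotDual B ≤ B) {σ : Type*} [Fintype σ] [DecidableEq σ]
    (hσ : Fintype.card σ + 2 * Module.finrank F (dotDual B) = n) :
    ∃ e f : σ → Fin n → F, IsDualFrame (dotDual B) B e f := by
  obtain ⟨W', hW'⟩ := Submodule.exists_isCompl (dotDual B)
  set W := W' ⊓ B with hW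
  have hsup : dotDual B ⊔ W = B := by
    rw [hW, ← sup_inf_assoc_of_le _ hB, hW'.sup_eq_top, top_inf_eq]
  have hinf : dotDual B ⊓ W = ⊥ := by
    rw [hW, ← inf_assoc, hW'.inf_eq_bot, bot_inf_eq]
  have hfin : Module.finrank F W = Fintype.card σ := by
    have h1 := Submodule.finrank_sup_add_finrank_inf_eq (dotDual B) W
    rw [hsup, hinf, finrank_bot] at h1
    have h2 := finrank_dotDual_add (B := B)
    omega
  have hWB : ∀ w : W, (w : Fin n → F) ∈ B := fun w => w.2.2
  -- A vector of W orthogonal to W is orthogonal to N + W = B, so it lies in N ∩ W = 0; thus the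
  -- form is nondegenerate on W.
  have hzero : ∀ w : W, (∀ w' : W, (w : Fin n → F) ⬝ᵥ w' = 0) → w = 0 := by
    intro w hw
    have h1 : (w : Fin n → F) ∈ dotDual B := by
      intro y hy
      rw [← hsup, Submodule.mem_sup] at hy
      obtain ⟨z, hz, w', hw', rfl⟩ := hy
      have h2 := hw ⟨w', hw'⟩
      have h3 : z ⬝ᵥ (w : Fin n → F) = 0 := by
        rw [dotProduct_comm]
        exact hz _ (hWB w)
      simp only [dotProductBilin_apply_apply, add_dotProduct, h3, zero_add]
      rw [dotProduct_comm]
      exact h2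
    have h4 : (w : Fin n → F) ∈ dotDual B ⊓ W := ⟨h1, w.2⟩
    rw [hinf, Submodule.mem_bot] at h4
    exact Subtype.ext h4
  let b₀ : LinearMap.BilinForm F W :=
    LinearMap.BilinForm.restrict (dotProductBilin F F : LinearMap.BilinForm F (Fin n → F)) W
  have hb₀ : b₀.Nondegenerate :=
    ⟨fun w hw => hzero w hw, fun w hw => hzero w fun w' => by
      rw [dotProduct_comm]
      exact hw w'⟩
  let e : Module.Basis σ F W :=
    (Module.finBasisOfFinrankEq F W hfin).reindex (Fintype.equivFin σ).symm
  let f : Module.Basis σ F W := b₀.dualBasis hb₀ e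
  have hsub : ∀ (g : Module.Basis σ F W), ∀ x ∈ B, (∀ s, x ⬝ᵥ (g s : Fin n → F) = 0) →
      x ∈ dotDual B := by
    intro g x hx hg
    rw [← hsup, Submodule.mem_sup] at hx
    obtain ⟨z, hz, w, hw, rfl⟩ := hx
    have h1 : (⟨w, hw⟩ : W) = 0 := by
      refine hzero _ fun w' => ?_
      have h2 : b₀ ⟨w, hw⟩ = 0 := by
        refine g.ext fun s => ?_
        have h3 := hg s
        rw [add_dotProduct, dotProduct_comm z, mem_dotDual.1 hz _ (hWB (g s)), zero_add] at h3
        exact h3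
      exact DFunLike.congr_fun h2 w'
    have h4 : w = 0 := congrArg Subtype.val h1
    rw [h4, add_zero]
    exact hz
  refine ⟨fun s => e s, fun s => f s, hB, fun x => ?_, fun s => hWB _, fun s => hWB _,
    fun s t => ?_, hsub f, hsub e⟩
  · conv_lhs => rw [← dotDual_dotDual (B := B)]
    exact mem_dotDual
  · rw [dotProduct_comm]
    exact LinearMap.BilinForm.apply_dualBasis_left hb₀ e t s

end DotDual

/-! ### Cyclic codes: BCH bound, dimension, dual containment -/

section CyclicCode

open Polynomial

variable {F : Type*} [Field F] {E : Type*} [Field E] [Algebra F E]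

theorem aeval_degreeLTEquiv_symm {n : ℕ} (c : Fin n → F) (x : E) :
    aeval x ((degreeLTEquiv F n).symm c : F[X]) = ∑ i, algebraMap F E (c i) * x ^ (i : ℕ) := by
  simp [degreeLTEquiv, aeval_monomial]

/-- The BCH bound. -/
theorem le_card_support_of_sum_eq_zero {n δ : ℕ} {α : E} (hα : IsPrimitiveRoot α n)
    {c : Fin n → F} (hc0 : c ≠ 0)
    (hc : ∀ t ∈ Set.Ico 1 δ, ∑ i : Fin n, algebraMap F E (c i) * (α ^ t) ^ (i : ℕ) = 0)
    [DecidablePred fun i => c i ≠ 0] :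
    δ ≤ (Finset.univ.filter fun i => c i ≠ 0).card := by
  set s := Finset.univ.filter fun i => c i ≠ 0 with hs
  by_contra! hlt
  obtain ⟨i₀, hi₀⟩ := Function.ne_iff.1 hc0
  have hi₀s : i₀ ∈ s := by simpa [hs] using hi₀
  -- This polynomial vanishes at all support locators except that of `i₀`. The factor X removes the
  -- constant term, and the degree is below δ, so pairing it with `c` uses only the known zeros; yet
  -- the single term at `i₀` survives.
  set h : E[X] := X * ∏ i ∈ s.erase i₀, (X - C (α ^ (i : ℕ))) with hh
  have hpm : (∏ i ∈ s.erase i₀, (X - C (α ^ (i : ℕ)))).Monic :=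
    monic_prod_of_monic _ _ fun t _ => monic_X_sub_C _
  have hdeg : h.natDegree = s.card := by
    rw [hh, monic_X.natDegree_mul hpm, natDegree_X,
      natDegree_prod_of_monic _ _ fun t _ => monic_X_sub_C _]
    simp only [natDegree_X_sub_C, Finset.sum_const, smul_eq_mul, mul_one,
      Finset.card_erase_of_mem hi₀s]
    have := Finset.card_pos.2 ⟨i₀, hi₀s⟩
    omega
  have hsum : ∑ i : Fin n, algebraMap F E (c i) * h.eval (α ^ (i : ℕ)) = 0 := by
    simp only [eval_eq_sum_range, hdeg, Finset.mul_sum]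
    rw [Finset.sum_comm]
    refine Finset.sum_eq_zero fun t ht => ?_
    rcases Nat.eq_zero_or_pos t with rfl | htpos
    · simp [hh]
    · have h1 := hc t ⟨htpos, by rw [Finset.mem_range] at ht; omega⟩
      rw [← mul_zero (h.coeff t), ← h1, Finset.mul_sum]
      refine Finset.sum_congr rfl fun i _ => ?_
      rw [← pow_mul, ← pow_mul, mul_comm (i : ℕ)]
      ring
  rw [Finset.sum_eq_single i₀] at hsum
  · have hne : h.eval (α ^ (i₀ : ℕ)) ≠ 0 := by
      rw [hh, eval_mul, eval_X, eval_prod]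
      refine mul_ne_zero (pow_ne_zero _ (hα.ne_zero (by have := i₀.2; omega)))
        (Finset.prod_ne_zero_iff.2 fun i hi => ?_)
      rw [eval_sub, eval_X, eval_C, sub_ne_zero]
      intro heq
      exact (Finset.ne_of_mem_erase hi) (Fin.ext (hα.pow_inj i₀.2 i.2 heq)).symm
    rcases mul_eq_zero.1 hsum with h1 | h1
    · exact hi₀ ((map_eq_zero _).1 h1)
    · exact hne h1
  · intro i _ hi
    by_cases hci : c i = 0
    · simp [hci]
    · have his : i ∈ s.erase i₀ := Finset.mem_erase.2 ⟨hi, by simpa [hs] using hci⟩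
      rw [hh, eval_mul, eval_prod, Finset.prod_eq_zero his (by simp), mul_zero, mul_zero]
  · simp

variable [Fintype F]

theorem mem_range_algebraMap_of_pow_card_eq {x : E} (hx : x ^ Fintype.card F = x) :
    x ∈ Set.range (algebraMap F E) := by
  have h1 : (X ^ Fintype.card F - X : F[X]) = ∏ a : F, (X - C a) := by
    have hmonic : (X ^ Fintype.card F - X : F[X]).Monic :=
      monic_X_pow_sub (by rw [degree_X]; exact_mod_cast Fintype.one_lt_card)
    have hroots := FiniteField.roots_X_pow_card_sub_X F
    have := prod_multiset_X_sub_C_of_monic_of_roots_card_eq hmonic (by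
      rw [hroots, FiniteField.X_pow_card_sub_X_natDegree_eq F Fintype.one_lt_card]
      rfl)
    rw [hroots] at this
    exact this.symm
  have h2 := congrArg (aeval x) h1
  rw [map_sub, map_pow, aeval_X, hx, sub_self, map_prod, eq_comm, Finset.prod_eq_zero_iff] at h2
  obtain ⟨a, -, ha⟩ := h2
  rw [map_sub, aeval_X, aeval_C, sub_eq_zero] at ha
  exact ⟨a, ha.symm⟩

/-- The q-power Frobenius is additive and fixes `F`, so evaluations at conjugate points are powers
of each other. -/
theorem sum_algebraMap_mul_pow_card {n : ℕ} (c : Fin n → F) (g : Fin n → E) (j : ℕ) :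
    ∑ i, algebraMap F E (c i) * g i ^ Fintype.card F ^ j =
      (∑ i, algebraMap F E (c i) * g i) ^ Fintype.card F ^ j := by
  induction j with
  | zero => simp
  | succ j ih =>
    have h1 := map_sum (FiniteField.frobeniusAlgHom F E)
      (fun i => algebraMap F E (c i) * g i ^ Fintype.card F ^ j) Finset.univ
    simp only [FiniteField.coe_frobeniusAlgHom, mul_pow, ← map_pow, FiniteField.pow_card,
      ← pow_mul, ← pow_succ] at h1
    rw [← h1, ih, ← pow_mul, pow_succ]

/-- The polynomial with zeros `α ^ t` for `t ∈ S` has coefficients in `F`, when `S` is closed under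
multiplication by `q`. -/
theorem exists_map_eq_prod_X_sub_C {n : ℕ} {α : E} (hα : IsPrimitiveRoot α n) {S : Finset ℕ}
    (hS : ∀ t ∈ S, t < n) (hSq : ∀ t ∈ S, t * Fintype.card F % n ∈ S)
    (hn : (Fintype.card F).Coprime n) :
    ∃ g : F[X], g.Monic ∧ g.natDegree = S.card ∧
      g.map (algebraMap F E) = ∏ t ∈ S, (X - C (α ^ t)) := by
  set P : E[X] := ∏ t ∈ S, (X - C (α ^ t)) with hP
  have hmap : P.map (FiniteField.frobeniusAlgHom F E : E →+* E) = P := by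
    have hinj : Set.InjOn (fun t => t * Fintype.card F % n) S := by
      intro t ht t' ht' h
      exact (Nat.ModEq.cancel_right_of_coprime hn.symm h).eq_of_lt_of_lt (hS t ht) (hS t' ht')
    have himg : S.image (fun t => t * Fintype.card F % n) = S :=
      Finset.eq_of_subset_of_card_le (Finset.image_subset_iff.2 hSq)
        (Finset.card_image_of_injOn hinj).ge
    rw [hP, Polynomial.map_prod]
    conv_rhs => rw [← himg, Finset.prod_image hinj]
    refine Finset.prod_congr rfl fun t _ => ?_
    rw [Polynomial.map_sub, map_X, map_C]
    congr 2
    have h1 : α ^ (t * Fintype.card F % n) = α ^ (t * Fintype.card F) := by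
      rw [hα.eq_orderOf, pow_mod_orderOf]
    rw [h1, pow_mul]
    rfl
  have hlift : P ∈ lifts (algebraMap F E) := by
    rw [lifts_iff_coeff_lifts]
    intro i
    apply mem_range_algebraMap_of_pow_card_eq
    conv_rhs => rw [← hmap, coeff_map]
    rfl
  have hPm : P.Monic := monic_prod_of_monic _ _ fun t _ => monic_X_sub_C _
  obtain ⟨g, hg, hdeg, hmonic⟩ := lifts_and_natDegree_eq_and_monic hlift hPm
  refine ⟨g, hmonic, ?_, hg⟩
  rw [hdeg, hP, natDegree_prod_of_monic _ _ fun t _ => monic_X_sub_C _]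
  simp only [natDegree_X_sub_C, Finset.sum_const, smul_eq_mul, mul_one]

/-- A cyclic code of length `n` has codimension equal to the size of its defining set. -/
theorem finrank_cyclicCode_add_card {n : ℕ} {α : E} (hα : IsPrimitiveRoot α n) {S : Finset ℕ}
    (hS : ∀ t ∈ S, t < n) (hSq : ∀ t ∈ S, t * Fintype.card F % n ∈ S)
    (hn : (Fintype.card F).Coprime n) :
    Module.finrank F (cyclicCode F n α (S : Set ℕ)) + S.card = n := by
  obtain ⟨g, hg, hdeg, hmap⟩ := exists_map_eq_prod_X_sub_C hα hS hSq hn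
  have hcard : S.card ≤ n := by
    simpa using Finset.card_le_card (fun t ht => Finset.mem_range.2 (hS t ht) :
      S ⊆ Finset.range n)
  -- Reduction of the word polynomial modulo g: its kernel is the code, and it is onto because deg g
  -- ≤ n.
  let Φ : (Fin n → F) →ₗ[F] AdjoinRoot g :=
    (AdjoinRoot.mkₐ g).toLinearMap ∘ₗ (degreeLT F n).subtype ∘ₗ
      (degreeLTEquiv F n).symm.toLinearMap
  have hker : LinearMap.ker Φ = cyclicCode F n α (S : Set ℕ) := by
    ext c
    have h1 : c ∈ LinearMap.ker Φ ↔ g ∣ ((degreeLTEquiv F n).symm c : F[X]) :=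
      AdjoinRoot.mk_eq_zero
    rw [h1, ← map_dvd_map' (algebraMap F E), hmap]
    have h2 : ∀ t, (X - C (α ^ t)) ∣ ((degreeLTEquiv F n).symm c : F[X]).map (algebraMap F E) ↔
        ∑ i : Fin n, algebraMap F E (c i) * (α ^ t) ^ (i : ℕ) = 0 := by
      intro t
      rw [dvd_iff_isRoot, IsRoot, eval_map_algebraMap, aeval_degreeLTEquiv_symm]
    constructor
    · intro h t ht
      have h3 : X - C (α ^ t) ∣ ∏ t ∈ S, (X - C (α ^ t)) :=
        Finset.dvd_prod_of_mem (fun t => X - C (α ^ t)) (Finset.mem_coe.1 ht)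
      exact (h2 t).1 (h3.trans h)
    · intro h
      refine Finset.prod_dvd_of_coprime (fun t ht t' ht' hne => ?_) fun t ht => (h2 t).2 (h t ht)
      change IsCoprime (X - C (α ^ t)) (X - C (α ^ t'))
      refine isCoprime_X_sub_C_of_isUnit_sub (IsUnit.mk0 _ (sub_ne_zero.2 fun heq => hne ?_))
      exact hα.pow_inj (hS t ht) (hS t' ht') heq
  have hsurj : LinearMap.range Φ = ⊤ := by
    rw [LinearMap.range_eq_top]
    intro y
    obtain ⟨f, rfl⟩ := AdjoinRoot.mk_surjective y
    have hlt : f %ₘ g ∈ degreeLT F n := by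
      rw [mem_degreeLT]
      refine (degree_modByMonic_lt f hg).trans_le ?_
      rw [degree_eq_natDegree hg.ne_zero, hdeg]
      exact_mod_cast hcard
    refine ⟨degreeLTEquiv F n ⟨_, hlt⟩, ?_⟩
    have : Φ (degreeLTEquiv F n ⟨_, hlt⟩) = AdjoinRoot.mk g (f %ₘ g) := by
      simp [Φ]
    rw [this, AdjoinRoot.mk_eq_mk, modByMonic_eq_sub_mul_div f g]
    exact ⟨-(f /ₘ g), by ring⟩
  have hfin := LinearMap.finrank_range_add_finrank_ker Φ
  rw [hker, hsurj, finrank_top, Module.finrank_fin_fun] at hfin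
  have hadj : Module.finrank F (AdjoinRoot g) = S.card := by
    rw [← hdeg]
    exact finrank_quotient_span_eq_natDegree
  omega

/-- Otherwise the trace polynomial, of degree at most q^(m-1) < n, would have the n distinct roots
α^k z. -/
theorem eq_zero_of_forall_sum_pow_eq_zero {q n m : ℕ} (hq : 1 < q) {α : E} (hα : IsPrimitiveRoot α n) (hm : 0 < m)
    (hn : q ^ (m - 1) < n) {z : E}
    (hz : ∀ k, ∑ j ∈ Finset.range m, (α ^ k * z) ^ q ^ j = 0) : z = 0 := by
  by_contra hz0
  set P : E[X] := ∑ j ∈ Finset.range m, X ^ q ^ j with hP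
  have hP0 : P ≠ 0 := by
    intro h0
    have h1 := congrArg (fun Q => coeff Q 1) h0
    simp only [hP, finsetSum_coeff, coeff_X_pow, coeff_zero] at h1
    rw [Finset.sum_eq_single 0] at h1
    · simp at h1
    · intro j _ hj
      rw [if_neg (Nat.one_lt_pow hj hq).ne]
    · intro h2
      exact absurd (Finset.mem_range.2 hm) h2
  have hdeg : P.natDegree ≤ q ^ (m - 1) := by
    refine natDegree_sum_le_of_forall_le _ _ fun j hj => ?_
    rw [natDegree_X_pow]
    rw [Finset.mem_range] at hj
    exact Nat.pow_le_pow_right hq.le (by omega)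
  classical
  have hinj : Set.InjOn (fun k => α ^ k * z) (Finset.range n) := by
    intro k hk k' hk' h
    simp only [Finset.coe_range, Set.mem_Iio] at hk hk'
    exact hα.pow_inj hk hk' (mul_right_cancel₀ hz0 h)
  have hcard := card_le_degree_of_subset_roots (p := P)
    (Z := (Finset.range n).image fun k => α ^ k * z) (by
      intro x hx
      rw [Finset.mem_val, Finset.mem_image] at hx
      obtain ⟨k, -, rfl⟩ := hx
      rw [mem_roots hP0, IsRoot, hP, eval_finsetSum]
      simpa using hz k)
  rw [Finset.card_image_of_injOn hinj, Finset.card_range] at hcard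
  omega

/-- A cyclic code with zeros `α ^ t`, `t ∈ A`, contains its dual if no element of `A` is conjugate
to the negative of an element of `A`. -/
theorem dotDual_le_of_forall_not_dvd {n m : ℕ} {α : E} (hα : IsPrimitiveRoot α n)
    (hn : n = Fintype.card F ^ m - 1) (hn' : Fintype.card F ^ (m - 1) < n) (hm : 0 < m)
    {B : Submodule F (Fin n → F)} {A : Set ℕ}
    (hB : ∀ c, c ∈ B ↔ ∀ t ∈ A, ∑ i : Fin n, algebraMap F E (c i) * (α ^ t) ^ (i : ℕ) = 0)
    (hA : ∀ a ∈ A, ∀ t ∈ A, ∀ j < m, ¬ n ∣ a * Fintype.card F ^ j + t) :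
    dotDual B ≤ B := by
  intro x hx
  rw [hB]
  intro a ha
  set q := Fintype.card F with hq
  have hq1 : 1 < q := Fintype.one_lt_card
  have hαq : ∀ l, (α ^ l) ^ q ^ m = α ^ l := by
    intro l
    have : q ^ m = n + 1 := by omega
    rw [this, pow_succ, ← pow_mul α l n, mul_comm l n, pow_mul α n l, hα.pow_eq_one, one_pow, one_mul]
  refine eq_zero_of_forall_sum_pow_eq_zero hq1 hα hm hn' fun k => ?_
  -- Delsarte's argument: the traces of α^(k+ai) from the field of q^m elements form a word over
  -- `F`. Once it is shown to lie in B, its product with `x` is the trace of α^k times the value of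
  -- `x` at α^a.
  have hfix : ∀ i : Fin n, ∃ c : F, algebraMap F E c =
      ∑ j ∈ Finset.range m, (α ^ (k + a * i)) ^ q ^ j := by
    intro i
    apply mem_range_algebraMap_of_pow_card_eq
    have h1 := map_sum (FiniteField.frobeniusAlgHom F E)
      (fun j => (α ^ (k + a * i)) ^ q ^ j) (Finset.range m)
    simp only [FiniteField.coe_frobeniusAlgHom] at h1
    rw [h1]
    simp only [← hq, ← pow_mul (α ^ (k + a * i)), ← pow_succ]
    have h2 := Finset.sum_range_succ' (fun j => (α ^ (k + a * i)) ^ q ^ j) m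
    rw [Finset.sum_range_succ, hαq] at h2
    simp only [pow_zero, pow_one] at h2
    exact (add_right_cancel h2).symm
  choose c hc using hfix
  have hcB : c ∈ B := by
    rw [hB]
    intro t ht
    simp only [hc, Finset.sum_mul]
    rw [Finset.sum_comm]
    refine Finset.sum_eq_zero fun j hj => ?_
    have hne : α ^ (a * q ^ j + t) ≠ 1 := fun h =>
      hA a ha t ht j (Finset.mem_range.1 hj) ((hα.pow_eq_one_iff_dvd _).1 h)
    -- The value of the trace word at α^t is a combination of geometric sums whose ratios are n-th
    -- roots of unity other than 1.
    have hgeom : ∑ i : Fin n, (α ^ (a * q ^ j + t)) ^ (i : ℕ) = 0 := by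
      rw [Fin.sum_univ_eq_sum_range (fun i => (α ^ (a * q ^ j + t)) ^ i) n]
      have h1 := geom_sum_mul (α ^ (a * q ^ j + t)) n
      rw [← pow_mul, mul_comm _ n, pow_mul, hα.pow_eq_one, one_pow, sub_self, mul_eq_zero] at h1
      exact h1.resolve_right (sub_ne_zero.2 hne)
    rw [← mul_zero (α ^ (k * q ^ j)), ← hgeom, Finset.mul_sum]
    refine Finset.sum_congr rfl fun i _ => ?_
    simp only [← pow_mul, ← pow_add]
    congr 1
    ring
  have h0 := congrArg (algebraMap F E) (hx c hcB)
  simp only [dotProductBilin_apply_apply, dotProduct, map_sum, map_mul, hc,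
    map_zero, Finset.sum_mul] at h0
  rw [Finset.sum_comm] at h0
  rw [← h0]
  refine Finset.sum_congr rfl fun j _ => ?_
  rw [Finset.mul_sum]
  have h1 := sum_algebraMap_mul_pow_card x (fun i : Fin n => α ^ (k + a * i)) j
  rw [show ∑ i : Fin n, α ^ k * (algebraMap F E (x i) * (α ^ a) ^ (i : ℕ)) =
    ∑ i : Fin n, algebraMap F E (x i) * α ^ (k + a * i) from
    Finset.sum_congr rfl fun i _ => by rw [pow_add, pow_mul]; ring, ← h1]
  exact Finset.sum_congr rfl fun i _ => mul_comm _ _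

end CyclicCode

/-! ### Arithmetic of cyclotomic cosets -/

section CosetArithmetic

variable {q m D : ℕ}

theorem mul_pow_add_lt (hq : 0 < q) (hD : D * (q ^ (m / 2) + 1) < q ^ m - 1) {a t j : ℕ}
    (ha : a ≤ D) (ht : t ≤ D) (hj : j ≤ m / 2) : a * q ^ j + t < q ^ m - 1 := by
  refine lt_of_le_of_lt ?_ hD
  rw [mul_add, mul_one]
  gcongr

theorem pow_eq_sub_one_add_one (hq : 0 < q) (m : ℕ) : q ^ m = q ^ m - 1 + 1 := by
  have := Nat.pow_pos (n := m) hq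
  omega

theorem pow_modEq_one (hq : 0 < q) (m : ℕ) : q ^ m ≡ 1 [MOD (q ^ m - 1)] := by
  conv_lhs => rw [pow_eq_sub_one_add_one hq m]
  simp [Nat.ModEq]

theorem mul_pow_mul_pow_modEq (hq : 0 < q) (a : ℕ) {j : ℕ} (hj : j ≤ m) :
    a * q ^ j * q ^ (m - j) ≡ a [MOD (q ^ m - 1)] := by
  rw [mul_assoc, ← pow_add, Nat.add_sub_cancel' hj]
  simpa using (pow_modEq_one hq m).mul_left a

theorem coprime_pow_sub_one (hq : 0 < q) (hm : 0 < m) : q.Coprime (q ^ m - 1) := by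
  have h1 : (q ^ m).Coprime (q ^ m - 1) := by
    conv_lhs => rw [pow_eq_sub_one_add_one hq m]
    simp
  exact h1.coprime_dvd_left (dvd_pow_self q hm.ne')

/-- For j ≤ m/2 the sum is positive and below the modulus. For larger j, multiplying by q^(m-j)
exchanges the roles of a and t and brings the exponent below m/2. -/
theorem not_dvd_mul_pow_add (hq : 0 < q) (hD : D * (q ^ (m / 2) + 1) < q ^ m - 1) {a t j : ℕ}
    (ha0 : 0 < a) (ha : a ≤ D) (ht0 : 0 < t) (ht : t ≤ D) (hj : j < m) :
    ¬ q ^ m - 1 ∣ a * q ^ j + t := by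
  intro hdvd
  rcases le_or_gt j (m / 2) with hj2 | hj2
  · exact (Nat.le_of_dvd (by omega) hdvd).not_gt (mul_pow_add_lt hq hD ha ht hj2)
  · have h1 : a * q ^ j * q ^ (m - j) + t * q ^ (m - j) ≡ a + t * q ^ (m - j) [MOD (q ^ m - 1)] :=
      (mul_pow_mul_pow_modEq hq a hj.le).add_right _
    have h2 : q ^ m - 1 ∣ a + t * q ^ (m - j) := by
      rw [← (h1.dvd_iff dvd_rfl), ← add_mul]
      exact hdvd.mul_right _
    have h3 := mul_pow_add_lt hq hD ht ha (j := m - j) (by omega)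
    exact (Nat.le_of_dvd (by omega) h2).not_gt (by omega)

/-- With the exponent at most m/2, directly or after multiplying by q^(m-l), both sides are below
the modulus and hence equal; a positive power of q would then divide a or b. -/
theorem eq_of_modEq_mul_pow (hq : 0 < q) (hD : D * (q ^ (m / 2) + 1) < q ^ m - 1) {a b l : ℕ}
    (ha : a ≤ D) (haq : ¬ q ∣ a) (hb : b ≤ D) (hbq : ¬ q ∣ b) (hl : l < m)
    (h : a ≡ b * q ^ l [MOD (q ^ m - 1)]) : a = b ∧ l = 0 := by
  have hlt : ∀ {c j : ℕ}, c ≤ D → j ≤ m / 2 → c * q ^ j < q ^ m - 1 := fun hc hj =>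
    mul_pow_add_lt hq hD hc (Nat.zero_le D) hj
  have hlt' : ∀ {c : ℕ}, c ≤ D → c < q ^ m - 1 := fun hc => by
    simpa using hlt hc (Nat.zero_le _)
  rcases le_or_gt l (m / 2) with hl2 | hl2
  · have h1 := h.eq_of_lt_of_lt (hlt' ha) (hlt hb hl2)
    rcases Nat.eq_zero_or_pos l with rfl | hl0
    · exact ⟨by simpa using h1, rfl⟩
    · exact absurd (h1 ▸ (dvd_pow_self q hl0.ne').mul_left b) haq
  · have h1 := ((h.mul_right (q ^ (m - l))).trans
      (mul_pow_mul_pow_modEq hq b hl.le)).eq_of_lt_of_lt (hlt ha (by omega)) (hlt' hb)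
    exact absurd (h1 ▸ (dvd_pow_self q (by omega : m - l ≠ 0)).mul_left a) hbq

theorem eq_of_mul_pow_modEq_mul_pow (hq : 0 < q) (hD : D * (q ^ (m / 2) + 1) < q ^ m - 1)
    {a b i j : ℕ} (ha : a ≤ D) (haq : ¬ q ∣ a) (hb : b ≤ D) (hbq : ¬ q ∣ b) (hi : i < m)
    (hj : j < m) (h : a * q ^ i ≡ b * q ^ j [MOD (q ^ m - 1)]) : a = b ∧ i = j := by
  wlog hij : i ≤ j generalizing a b i j
  · have := this hb hbq ha haq hj hi h.symm (by omega)
    exact ⟨this.1.symm, this.2.symm⟩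
  have h1 : a * q ^ i ≡ b * q ^ (j - i) * q ^ i [MOD (q ^ m - 1)] := by
    rwa [mul_assoc, ← pow_add, Nat.sub_add_cancel hij]
  have h2 := Nat.ModEq.cancel_right_of_coprime
    (((coprime_pow_sub_one hq (by omega)).pow_left i).symm) h1
  have h3 := eq_of_modEq_mul_pow hq hD ha haq hb hbq (by omega) h2
  exact ⟨h3.1, by omega⟩

/-- The union of the cyclotomic cosets of `1, …, δ - 1` as a finset. -/
def bchDefiningSet (q m δ : ℕ) : Finset ℕ :=
  (((Finset.Ico 1 δ).filter fun a => ¬ q ∣ a) ×ˢ Finset.range m).image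
    fun x => x.1 * q ^ x.2 % (q ^ m - 1)

theorem coe_bchDefiningSet (hq : 1 < q) (hm : 0 < m) (δ : ℕ) :
    (bchDefiningSet q m δ : Set ℕ) = ⋃ a ∈ Set.Ico 1 δ, cyclotomicCoset q (q ^ m - 1) a := by
  ext t
  simp only [bchDefiningSet, Finset.coe_image, Set.mem_image, Finset.mem_coe, Finset.mem_product,
    Finset.mem_filter, Finset.mem_Ico, Finset.mem_range, Prod.exists, Set.mem_iUnion, Set.mem_Ico,
    cyclotomicCoset, Set.mem_ofPred_eq, exists_prop]
  constructor
  · rintro ⟨a, i, ⟨⟨ha, -⟩, -⟩, rfl⟩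
    exact ⟨a, ha, i, rfl⟩
  · rintro ⟨a, ha, i, rfl⟩
    -- Powers of q in a move into the exponent, which only matters modulo m.
    obtain ⟨s, b, hb, rfl⟩ := Nat.exists_eq_pow_mul_and_not_dvd (n := a) (by omega) q hq.ne'
    have hs : 0 < q ^ s := Nat.pow_pos (by omega)
    have hb0 : 0 < b := Nat.pos_of_ne_zero fun h => hb (h ▸ dvd_zero q)
    refine ⟨b, (s + i) % m, ⟨⟨⟨hb0, ?_⟩, hb⟩, Nat.mod_lt _ hm⟩, ?_⟩
    · exact (Nat.le_mul_of_pos_left b hs).trans_lt ha.2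
    · rw [mul_comm (q ^ s), mul_assoc, ← pow_add]
      conv_rhs => rw [← Nat.mod_add_div (s + i) m, pow_add, pow_mul]
      have h1 := ((pow_modEq_one (by omega : 0 < q) m).pow ((s + i) / m)).mul_left
        (b * q ^ ((s + i) % m))
      rw [one_pow, mul_one, mul_assoc] at h1
      exact h1.symm

theorem card_bchDefiningSet (hq : 0 < q) {δ : ℕ}
    (hD : (δ - 1) * (q ^ (m / 2) + 1) < q ^ m - 1) :
    (bchDefiningSet q m δ).card = m * ((Finset.Ico 1 δ).filter fun a => ¬ q ∣ a).card := by
  rw [bchDefiningSet, Finset.card_image_of_injOn, Finset.card_product, Finset.card_range, mul_comm]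
  rintro ⟨a, i⟩ hx ⟨b, j⟩ hy h
  simp only [Finset.coe_product, Set.mem_prod, Finset.mem_coe, Finset.mem_filter, Finset.mem_Ico,
    Finset.mem_range] at hx hy
  obtain ⟨h1, h2⟩ := eq_of_mul_pow_modEq_mul_pow hq hD (by omega) hx.1.2 (by omega) hy.1.2
    hx.2 hy.2 h
  rw [h1, h2]

theorem mul_mod_mem_bchDefiningSet (hq : 1 < q) (hm : 0 < m) {δ t : ℕ}
    (ht : t ∈ bchDefiningSet q m δ) : t * q % (q ^ m - 1) ∈ bchDefiningSet q m δ := by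
  rw [← Finset.mem_coe, coe_bchDefiningSet hq hm] at ht ⊢
  simp only [Set.mem_iUnion, cyclotomicCoset, Set.mem_ofPred_eq, exists_prop] at ht ⊢
  obtain ⟨a, ha, i, rfl⟩ := ht
  refine ⟨a, ha, i + 1, ?_⟩
  rw [Nat.mod_mul_mod, pow_succ, mul_assoc]

/-- With D = δ - 1 the count is c = D - ⌊D/q⌋, and D(1 - 1/q) = c - (D mod q)/q lies in (c - 1, c].
-/
theorem card_filter_not_dvd (hq : 0 < q) {δ : ℕ} (hδ : 1 ≤ δ) :
    ((Finset.Ico 1 δ).filter fun a => ¬ q ∣ a).card = ⌈((δ : ℚ) - 1) * (1 - 1 / (q : ℚ))⌉₊ := by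
  obtain ⟨D, rfl⟩ : ∃ D, δ = D + 1 := ⟨δ - 1, by omega⟩
  have h1 : Finset.Ico 1 (D + 1) = Finset.Ioc 0 D := by
    ext
    simp only [Finset.mem_Ico, Finset.mem_Ioc]
    omega
  have h2 := Finset.card_filter_add_card_filter_not (s := Finset.Ioc 0 D) (fun a => q ∣ a)
  rw [Nat.Ioc_filter_dvd_card_eq_div, Nat.card_Ioc, Nat.sub_zero] at h2
  rw [h1]
  set c := ((Finset.Ioc 0 D).filter fun a => ¬ q ∣ a).card with hc
  have h3 := Nat.div_add_mod D q
  have h4 := Nat.mod_lt D hq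
  have hq' : (0 : ℚ) < q := by exact_mod_cast hq
  have h5 : ((((D + 1 : ℕ) : ℚ)) - 1) * (1 - 1 / (q : ℚ)) = c - ((D % q : ℕ) : ℚ) / q := by
    have h2' : (D : ℚ) = ((D / q : ℕ) : ℚ) + c := by exact_mod_cast h2.symm
    have h3' : (q : ℚ) * ((D / q : ℕ) : ℚ) + ((D % q : ℕ) : ℚ) = D := by exact_mod_cast h3
    push_cast [-Nat.cast_div_charZero]
    field_simp
    linear_combination (q : ℚ) * h2' + h3'
  have h6 : ((D % q : ℕ) : ℚ) / q < 1 := by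
    rw [div_lt_one hq']
    exact_mod_cast h4
  have h7 : 0 ≤ ((D % q : ℕ) : ℚ) / q := by positivity
  rw [h5]
  symm
  rcases Nat.eq_zero_or_pos c with hc0 | hc0
  · rw [hc0, Nat.ceil_eq_zero]
    push_cast
    linarith
  · rw [Nat.ceil_eq_iff hc0.ne']
    have : ((c - 1 : ℕ) : ℚ) = c - 1 := by
      rw [Nat.cast_sub hc0, Nat.cast_one]
    rw [this]
    constructor <;> linarith

theorem natCeil_natCast_div_two (m : ℕ) : ⌈(m : ℚ) / 2⌉₊ = (m + 1) / 2 := by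
  obtain ⟨h, rfl | rfl⟩ := Nat.even_or_odd' m
  · rw [show ((2 * h : ℕ) : ℚ) / 2 = (h : ℕ) by push_cast; ring, Nat.ceil_natCast]
    omega
  · rw [show (2 * h + 1 + 1) / 2 = h + 1 by omega, Nat.ceil_eq_iff (by omega)]
    push_cast
    constructor <;> linarith

/-- With k = ⌊m/2⌋ the hypothesis reads δ - 1 ≤ q^k - 2 for even m and δ - 1 ≤ q(q^k - 1) for odd m.
In the odd case the product is at most q^m - q. -/
theorem sub_one_mul_pow_add_one_lt (hq : 1 < q) {δ : ℕ} (hδ : 2 ≤ δ)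
    (h : (δ : ℤ) ≤ (q : ℤ) ^ ⌈(m : ℚ) / 2⌉₊ - 1 - (if Odd m then (q : ℤ) - 2 else 0)) :
    (δ - 1) * (q ^ (m / 2) + 1) < q ^ m - 1 := by
  rw [natCeil_natCast_div_two] at h
  obtain ⟨D, rfl⟩ : ∃ D, δ = D + 1 := ⟨δ - 1, by omega⟩
  suffices hZ : (D : ℤ) * ((q : ℤ) ^ (m / 2) + 1) + 1 < (q : ℤ) ^ m by
    have : D * (q ^ (m / 2) + 1) + 1 < q ^ m := by exact_mod_cast hZ
    rw [Nat.add_sub_cancel]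
    omega
  have hq' : (1 : ℤ) < q := by exact_mod_cast hq
  obtain ⟨k, rfl | rfl⟩ := Nat.even_or_odd' m
  · rw [if_neg (by simp), show (2 * k + 1) / 2 = k by omega] at h
    rw [show 2 * k / 2 = k by omega, mul_comm 2 k, pow_mul]
    push_cast at h
    have : (0 : ℤ) < (q : ℤ) ^ k := by positivity
    nlinarith
  · rw [if_pos (by simp), show (2 * k + 1 + 1) / 2 = k + 1 by omega, pow_succ] at h
    rw [show (2 * k + 1) / 2 = k by omega, pow_succ, mul_comm 2 k, pow_mul]
    push_cast at h
    have : (0 : ℤ) < (q : ℤ) ^ k := by positivity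
    nlinarith

theorem pow_pred_lt_pow_sub_one (hq : 1 < q) (hm : 0 < m) (hD0 : 0 < D)
    (hD : D * (q ^ (m / 2) + 1) < q ^ m - 1) : q ^ (m - 1) < q ^ m - 1 := by
  obtain ⟨k, rfl⟩ : ∃ k, m = k + 1 := ⟨m - 1, by omega⟩
  rw [Nat.add_sub_cancel]
  rcases Nat.eq_zero_or_pos k with rfl | hk
  · have : D * 2 < q - 1 := by simpa using hD
    simp only [pow_zero, zero_add, pow_one]
    omega
  · have h1 : 1 < q ^ k := Nat.one_lt_pow hk.ne' hq
    have h2 : q ^ k * 2 ≤ q ^ (k + 1) := by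
      rw [pow_succ]
      exact Nat.mul_le_mul_left _ hq
    omega

end CosetArithmetic

/-! ### BCH codes and the main theorem -/

/-- Membership in a narrow-sense BCH code only has to be tested on `α, …, α ^ (δ - 1)`. -/
theorem mem_cyclicCode_iUnion_cyclotomicCoset {F : Type*} [Field F] [Fintype F] {E : Type*}
    [Field E] [Algebra F E] {n δ : ℕ} {α : E} (hα : IsPrimitiveRoot α n) (c : Fin n → F) :
    c ∈ cyclicCode F n α (⋃ a ∈ Set.Ico 1 δ, cyclotomicCoset (Fintype.card F) n a) ↔
      ∀ t ∈ Set.Ico 1 δ, ∑ i : Fin n, algebraMap F E (c i) * (α ^ t) ^ (i : ℕ) = 0 := by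
  have hmod : ∀ t, α ^ (t % n) = α ^ t := fun t => by
    rw [hα.eq_orderOf, pow_mod_orderOf]
  constructor
  · intro h t ht
    have h1 := h (t % n) (Set.mem_biUnion ht ⟨0, by simp⟩)
    rwa [hmod] at h1
  · intro h t ht
    simp only [Set.mem_iUnion, cyclotomicCoset, Set.mem_ofPred_eq, exists_prop] at ht
    obtain ⟨a, ha, j, rfl⟩ := ht
    have h1 := sum_algebraMap_mul_pow_card c (fun i : Fin n => (α ^ a) ^ (i : ℕ)) j
    rw [h a ha, zero_pow (pow_ne_zero _ Fintype.card_ne_zero)] at h1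
    rw [← h1, hmod]
    refine Finset.sum_congr rfl fun i _ => ?_
    rw [pow_mul, pow_right_comm]

theorem le_sympWeight_of_mem_prod {F : Type*} [Field F] [DecidableEq F] {n δ : ℕ}
    {B : Submodule F (Fin n → F)}
    (hB : ∀ c ∈ B, c ≠ 0 → δ ≤ (Finset.univ.filter fun i => c i ≠ 0).card)
    {v : (Fin n → F) × (Fin n → F)} (hv : v ∈ (B.prod B).toAddSubgroup) (hv0 : v ≠ 0) :
    δ ≤ sympWeight v := by
  by_cases h1 : v.1 = 0
  · have h2 : v.2 ≠ 0 := fun h2 => hv0 (Prod.ext h1 h2)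
    exact (hB _ hv.2 h2).trans (Finset.card_le_card
      (Finset.monotone_filter_right _ fun i _ hi => Or.inr hi))
  · exact (hB _ hv.1 h1).trans (Finset.card_le_card
      (Finset.monotone_filter_right _ fun i _ hi => Or.inl hi))

end

theorem mainTheorem12 (p : ℕ) [Fact p.Prime] (F : Type*) [Field F] [Fintype F] [DecidableEq F]
    [Algebra (ZMod p) F] (q : ℕ) (hq : Fintype.card F = q) (m : ℕ) (hm : 0 < m)
    (δ : ℕ) (hδ₁ : 2 ≤ δ)
    (hδ₂ : (δ : ℤ) ≤ (q : ℤ) ^ ⌈(m : ℚ) / 2⌉₊ - 1 - (if Odd m then (q : ℤ) - 2 else 0))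
    (r : ℕ) (hr : r + 2 * m * ⌈((δ : ℚ) - 1) * (1 - 1 / (q : ℚ))⌉₊ < q ^ m - 1) :
    ∃ (d : ℕ) (U : Matrix (Fin (q ^ m - 1) → F)
        (Fin (q ^ (q ^ m - 1 - 2 * m * ⌈((δ : ℚ) - 1) * (1 - 1 / (q : ℚ))⌉₊ - r)) ×
          Fin (q ^ r)) ℂ),
      δ ≤ d ∧ IsSubsystemBCHCode p δ
        (q ^ (q ^ m - 1 - 2 * m * ⌈((δ : ℚ) - 1) * (1 - 1 / (q : ℚ))⌉₊ - r)) (q ^ r) d U := by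
  subst hq
  set q := Fintype.card F with hq
  have hq1 : 1 < q := Fintype.one_lt_card
  have hq0 : 0 < q := by omega
  set n := q ^ m - 1 with hn
  have hD := sub_one_mul_pow_add_one_lt hq1 hδ₁ hδ₂
  have hn' : q ^ (m - 1) < n := pow_pred_lt_pow_sub_one hq1 hm (by omega) hD
  rw [← card_filter_not_dvd hq0 (by omega)] at hr ⊢
  set s := ((Finset.Ico 1 δ).filter fun a => ¬ q ∣ a).card with hs
  have hs0 : 0 < s := Finset.card_pos.2 ⟨1, by
    simp only [Finset.mem_filter, Finset.mem_Ico, Nat.dvd_one]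
    omega⟩
  -- In `F` the length n equals -1, so primitive n-th roots of unity exist in the algebraic closure.
  have hnF : NeZero (n : F) := ⟨by
    rw [hn, Nat.cast_sub (Nat.one_le_pow _ _ hq0), Nat.cast_pow, hq,
      FiniteField.cast_card_eq_zero, zero_pow hm.ne']
    simp⟩
  obtain ⟨α, hα⟩ := HasEnoughRootsOfUnity.exists_primitiveRoot (AlgebraicClosure F) n
  set B := cyclicCode F n α (⋃ a ∈ Set.Ico 1 δ, cyclotomicCoset q n a) with hB
  have hmem : ∀ c, c ∈ B ↔ ∀ t ∈ Set.Ico 1 δ,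
      ∑ i : Fin n, algebraMap F (AlgebraicClosure F) (c i) * (α ^ t) ^ (i : ℕ) = 0 :=
    mem_cyclicCode_iUnion_cyclotomicCoset hα
  have hdual : dotDual B ≤ B := by
    refine dotDual_le_of_forall_not_dvd hα hn hn' hm hmem fun a ha t ht j hj => ?_
    have ha2 := ha.2
    have ht2 := ht.2
    exact not_dvd_mul_pow_add hq0 hD ha.1 (by omega) ht.1 (by omega) hj
  have hrank : Module.finrank F (dotDual B) = m * s := by
    have h1 := finrank_cyclicCode_add_card hα (S := bchDefiningSet q m δ)
      (fun t ht => by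
        obtain ⟨x, -, rfl⟩ := Finset.mem_image.1 ht
        exact Nat.mod_lt _ (by omega))
      (fun t ht => mul_mod_mem_bchDefiningSet hq1 hm ht) (coprime_pow_sub_one hq0 hm)
    rw [coe_bchDefiningSet hq1 hm, card_bchDefiningSet hq0 hD] at h1
    change Module.finrank F B + m * s = n at h1
    have h2 := finrank_dotDual_add (B := B)
    omega
  set k := n - 2 * m * s - r with hk
  -- The strict bound on r leaves k > 0, so B × B exceeds the gauge code and the least weight is
  -- attained.
  have hk0 : k ≠ 0 := by omega
  have hsum : k + r + 2 * Module.finrank F (dotDual B) = n := by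
    rw [hrank, ← mul_assoc]
    omega
  obtain ⟨e, f, hef⟩ := exists_isDualFrame hdual (σ := Fin k ⊕ Fin r) (by
    rw [Fintype.card_sum, Fintype.card_fin, Fintype.card_fin]
    exact hsum)
  obtain ⟨v, hvB, hvC⟩ := hef.exists_notMem_gaugeCode hk0
  have hd : IsLeast {w | ∃ v ∈ (B.prod B).toAddSubgroup, v ∉ gaugeCode B e f ∧ sympWeight v = w}
      (sInf {w | ∃ v ∈ (B.prod B).toAddSubgroup, v ∉ gaugeCode B e f ∧ sympWeight v = w}) :=
    ⟨Nat.sInf_mem ⟨_, v, hvB, hvC, rfl⟩, fun _ hw => Nat.sInf_le hw⟩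
  have hne : dotDual B ≠ ⊥ := by
    intro hbot
    rw [hbot, finrank_bot] at hrank
    exact (Nat.mul_pos hm hs0).ne hrank
  have ha : Fintype.card (Fin k → F) = q ^ k := by simp [hq]
  have hb : Fintype.card (Fin r → F) = q ^ r := by simp [hq]
  refine ⟨_, cssEncoder (dotDual B) B f (Fintype.equivFinOfCardEq ha).symm
    (Fintype.equivFinOfCardEq hb).symm, ?_, B, gaugeCode B e f, ⟨α, hα, hB⟩, ?_,
    hef.isCliffordSubsystemCode hne hsum rfl rfl _ _ hd⟩
  · obtain ⟨w, hwB, hwC, hw⟩ := hd.1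
    rw [← hw]
    refine le_sympWeight_of_mem_prod (fun c hc hc0 => ?_) hwB fun h0 => hwC ?_
    · exact le_card_support_of_sum_eq_zero hα hc0 ((hmem c).1 hc)
    · rw [h0]
      exact zero_mem _
  · rw [gaugeCode_inf_sympDual hef, sympDual_prod_self hef]
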